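/- Let $(a_k)_{k\ge1}$ be defined by $a_1=1$ and $2(k+1)(4k^2+\tfrac54)a_{k+1}+(2k-1)a_k=0$ for $k\ge 1$, and put $X_0(x)=\tfrac52+\sum_{k\ge1}a_kx^{2k}$ and $h(x,y)=2X_0-xX_0'+y^2X_0'/x+\sqrt5$. On $D=\{(x,y)\in\mathbb R^2: x>0\}$ define $$a_1=\tfrac{2y}{xh}\bigl(X_0+\tfrac{\sqrt5}2\bigr),\quad b_1=-\tfrac{1}{xh}\bigl(X_0+\tfrac{\sqrt5}2+\sqrt5(x^2-y^2)\bigr),\quad c_1=-\tfrac{2}{xh}\bigl(X_0+\tfrac{\sqrt5}2\bigr),$$ $$a_2=-\tfrac1h\bigl(2X_0+\sqrt5-(x^2+y^2)\tfrac{X_0'}x\bigr),\quad b_2=-\tfrac{2y}h\bigl(\tfrac{X_0'}{2x}+\sqrt5\bigr),\quad c_2=\tfrac{2y}h\bigl(X_0''-\tfrac{X_0'}x\bigr)$$ (here $a_1,a_2$ denote these functions, not the coefficients of $X_0$). Let $F^0=[\phi,X_\alpha,X_\beta,\xi]$ be an analytic orthonormal frame field of $\mathbb R^4$ on $D$ with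 $$\partial_x\phi=-a_1X_\alpha,\quad \partial_x\xi=b_1X_\alpha,\quad \partial_xX_\beta=c_1X_\alpha,\quad \partial_xX_\alpha=a_1\phi-b_1\xi-c_1X_\beta,$$ $$\partial_y\phi=-a_2X_\beta,\quad \partial_y\xi=b_2X_\beta,\quad \partial_yX_\alpha=c_2X_\beta,\quad \partial_yX_\beta=a_2\phi-b_2\xi-c_2X_\alpha,$$ and let $f^0:D\to\mathbb R^4$ be a curvature surface on $D$ determined by $F^0$, that is, an analytic map with $$df^0=\frac{x^2-y^2}{xh}\,X_\alpha\,dx+\frac{2y}{h}\,X_\beta\,dy .$$ Say that a smooth curve $\gamma$ in $\mathbb R^4$ has a cusp of type $(2,3,4)$ at $t_0$ if, near $t_0$, it lies in an affine hyperplane, and there is an orthonormal basis $e_1,e_2,e_3$ of the direction space of that hyperplane such that the lowest-order nonvanishing derivatives at $t_0$ of $t\mapsto\langle\gamma(t)-\gamma(t_0),e_i\rangle$, $i=1,2,3$, have orders exactly $2$, $3$ and $4$ respectively (equivalently, in these coordinates $\gamma(t_0+t)-\gamma(t_0)=(at^2+O(t^3),\,bt^3+O(t^4),\,ct^4+O(t^5))$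 with $abc\ne0$). Then: 1. for every $y\neq0$, the $x$-curve $x\mapsto f^0(x,y)$ has a cusp of type $(2,3,4)$ at $x=|y|$; 2. for every $x>0$, the $y$-curve $y\mapsto f^0(x,y)$ has a cusp of type $(2,3,4)$ at $y=0$. -/

import Mathlib

open Filter Topology
open scoped ContDiff

noncomputable section

/-- The coefficients `a_k`, `k ≥ 1`: `a_1 = 1` and
`2(k+1)(4k²+5/4) a_{k+1} + (2k-1) a_k = 0`. The value at index `0` is not used. -/
def hypCoeff : ℕ → ℝ
  | 0 => 0
  | 1 => 1
  | (k + 2) =>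
      -((2 * ((k : ℝ) + 1) - 1) * hypCoeff (k + 1)) /
        (2 * (((k : ℝ) + 1) + 1) * (4 * ((k : ℝ) + 1) ^ 2 + 5 / 4))

/-- The generalized hypergeometric function `X₀(x) = 5/2 + ∑_{k ≥ 1} a_k x^{2k}`. -/
def X0 (x : ℝ) : ℝ := 5 / 2 + ∑' k : ℕ, hypCoeff (k + 1) * x ^ (2 * (k + 1))

/-- `h(x,y) = 2X₀ - xX₀' + y² (X₀'/x) + √5`; it is only used for `x > 0`. -/
def hFun (x y : ℝ) : ℝ :=
  2 * X0 x - x * deriv X0 x + y ^ 2 * (deriv X0 x / x) + √5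

/-- The open half plane `D = {(x,y) | x > 0}`. -/
def halfPlane : Set (ℝ × ℝ) := {p | 0 < p.1}

/-- The Euclidean space `ℝ⁴`. -/
abbrev E4 : Type := EuclideanSpace ℝ (Fin 4)

def coeffA1 (x y : ℝ) : ℝ := 2 * y / (x * hFun x y) * (X0 x + √5 / 2)

def coeffB1 (x y : ℝ) : ℝ :=
  -1 / (x * hFun x y) * (X0 x + √5 / 2 + √5 * (x ^ 2 - y ^ 2))

def coeffC1 (x y : ℝ) : ℝ := -2 / (x * hFun x y) * (X0 x + √5 / 2)

def coeffA2 (x y : ℝ) : ℝ :=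
  -1 / hFun x y * (2 * X0 x + √5 - (x ^ 2 + y ^ 2) * (deriv X0 x / x))

def coeffB2 (x y : ℝ) : ℝ := -2 * y / hFun x y * (deriv X0 x / (2 * x) + √5)

def coeffC2 (x y : ℝ) : ℝ := 2 * y / hFun x y * (deriv (deriv X0) x - deriv X0 x / x)

/-- The `dx`-part of the connection form `Ω = Ω₁ dx + Ω₂ dy`. -/
def omega1 (x y : ℝ) : Matrix (Fin 4) (Fin 4) ℝ :=
  !![0, coeffA1 x y, 0, 0;
     -coeffA1 x y, 0, coeffC1 x y, coeffB1 x y;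
     0, -coeffC1 x y, 0, 0;
     0, -coeffB1 x y, 0, 0]

/-- The `dy`-part of the connection form `Ω = Ω₁ dx + Ω₂ dy`. -/
def omega2 (x y : ℝ) : Matrix (Fin 4) (Fin 4) ℝ :=
  !![0, 0, coeffA2 x y, 0;
     0, 0, -coeffC2 x y, 0;
     -coeffA2 x y, coeffC2 x y, 0, coeffB2 x y;
     0, 0, -coeffB2 x y, 0]

/-- `F = [φ, X_α, X_β, ξ] = [F 0, F 1, F 2, F 3]` is an analytic orthonormal frame field of `ℝ⁴`
on `D` that solves `dF = F Ω`, where the `F j` are the columns of the matrix `F`. -/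
structure IsFrameField (F : Fin 4 → ℝ × ℝ → E4) : Prop where
  analytic : ∀ j, AnalyticOnNhd ℝ (F j) halfPlane
  orthonormal : ∀ p ∈ halfPlane, Orthonormal ℝ (fun j => F j p)
  deriv_x : ∀ x y : ℝ, 0 < x → ∀ j,
    HasDerivAt (fun s => F j (s, y)) (∑ i, omega1 x y i j • F i (x, y)) x
  deriv_y : ∀ x y : ℝ, 0 < x → ∀ j,
    HasDerivAt (fun s => F j (x, s)) (∑ i, omega2 x y i j • F i (x, y)) y

/-- `f` is a curvature surface on `D` determined by the frame field `F`:
it is analytic and `df = ((x² - y²)/(x h)) X_α dx + (2y/h) X_β dy`. -/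
structure IsCurvatureSurfaceOf (F : Fin 4 → ℝ × ℝ → E4) (f : ℝ × ℝ → E4) : Prop where
  frame : IsFrameField F
  analytic : AnalyticOnNhd ℝ f halfPlane
  deriv_x : ∀ x y : ℝ, 0 < x →
    HasDerivAt (fun s => f (s, y)) (((x ^ 2 - y ^ 2) / (x * hFun x y)) • F 1 (x, y)) x
  deriv_y : ∀ x y : ℝ, 0 < x →
    HasDerivAt (fun s => f (x, s)) ((2 * y / hFun x y) • F 2 (x, y)) y

/-- The lowest nonvanishing derivative of `w` at `t₀` (the value of `w` being the derivative of
order `0`) has order `n`. For smooth `w` this says that `w (t₀ + t) = c tⁿ + O(tⁿ⁺¹)`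
with `c ≠ 0`. -/
def LowestDerivOrder (w : ℝ → ℝ) (t₀ : ℝ) (n : ℕ) : Prop :=
  (∀ k < n, iteratedDeriv k w t₀ = 0) ∧ iteratedDeriv n w t₀ ≠ 0

/-- The curve `γ` has a cusp of type `(2,3,4)` at `t₀`: near `t₀` it is smooth and lies in an
affine hyperplane, orthogonal to `e 3`, and its coordinates in that hyperplane with respect to the
origin `γ t₀` and the orthonormal directions `e 0, e 1, e 2` have leading terms
`a t²`, `b t³`, `c t⁴` with `a b c ≠ 0`. -/
def HasCusp234 (γ : ℝ → E4) (t₀ : ℝ) : Prop :=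
  ContDiffAt ℝ ∞ γ t₀ ∧
  ∃ e : Fin 4 → E4, Orthonormal ℝ e ∧
    (∀ᶠ t in 𝓝 t₀, inner ℝ (γ t - γ t₀) (e 3) = 0) ∧
    LowestDerivOrder (fun t => inner ℝ (γ t - γ t₀) (e 0)) t₀ 2 ∧
    LowestDerivOrder (fun t => inner ℝ (γ t - γ t₀) (e 1)) t₀ 3 ∧
    LowestDerivOrder (fun t => inner ℝ (γ t - γ t₀) (e 2)) t₀ 4

end

noncomputable section

/-! Along each coordinate curve the velocity is a scalar speed `l` times a unit frame vector `T`,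
and `l` has a simple zero at the claimed cusp. Two of the other three frame directions recombine
into a constant unit vector `W`, so the curve lies in a hyperplane, and `T' = k (U + r V)` with `k ≠
0` and `r' ≠ 0` at the cusp. Hence `T` has coordinates of orders 0, 1, 2 in a suitable orthonormal
basis; multiplying by `l` and integrating raises each order by 2 (`lowestDerivOrder_add_two`,
`hasCusp234_of_frame`). The constant `W` exists because `a₁ = -y c₁` on an x-curve, and because `b₂
: c₂` does not depend on y on a y-curve. The nonvanishing conditions reduce to sign facts about
`X₀`. With `z = x²` and `X₀ = X(z)`, the differential equation has a quadratic first integral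
(`x0Series_first_integral`), which forces `X' > 0` and `X - z X' > 0`, and therefore `h > 0`. -/

/-! ### Everywhere convergent power series and termwise differentiation. -/

/-- The sum of the power series with coefficients `b`. -/
def seriesSum (b : ℕ → ℝ) (z : ℝ) : ℝ := ∑' k, b k * z ^ k

/-- The power series with coefficients `b` converges absolutely everywhere. -/
def IsEntire (b : ℕ → ℝ) : Prop := ∀ r : ℝ, 0 ≤ r → Summable fun k => |b k| * r ^ k

/-- Coefficients of the derivative of a power series. -/
def derivCoeff (b : ℕ → ℝ) (k : ℕ) : ℝ := (k + 1) * b (k + 1)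

/-- Coefficients of the Euler derivative `z d/dz` of a power series. -/
def eulerCoeff (b : ℕ → ℝ) (k : ℕ) : ℝ := k * b k

/-- The polynomial factor is absorbed by enlarging the radius: `k + 1 ≤ 2 ^ (k + 1)`. -/
theorem IsEntire.derivCoeff {b : ℕ → ℝ} (hb : IsEntire b) : IsEntire (derivCoeff b) := by
  intro r hr
  have h := (summable_nat_add_iff 1).2 (hb (2 * (r + 1)) (by positivity))
  refine Summable.of_nonneg_of_le (fun k => by positivity) (fun k => ?_) h
  have h1 : ((k : ℝ) + 1) ≤ 2 ^ (k + 1) := by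
    have := (Nat.lt_two_pow_self (n := k + 1)).le
    exact_mod_cast this
  have h2 : r ^ k ≤ (r + 1) ^ (k + 1) :=
    (pow_le_pow_left₀ hr (by linarith) k).trans (pow_le_pow_right₀ (by linarith) (by omega))
  have h3 : |_root_.derivCoeff b k| = (k + 1) * |b (k + 1)| := by
    rw [_root_.derivCoeff, abs_mul, abs_of_nonneg (by positivity)]
  rw [h3, mul_pow]
  calc ((k : ℝ) + 1) * |b (k + 1)| * r ^ k = |b (k + 1)| * ((k + 1) * r ^ k) := by ring
    _ ≤ _ := by gcongr

theorem IsEntire.eulerCoeff {b : ℕ → ℝ} (hb : IsEntire b) : IsEntire (eulerCoeff b) := by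
  intro r hr
  refine Summable.of_nonneg_of_le (fun k => by positivity) (fun k => ?_)
    (hb (2 * r) (by positivity))
  have h1 : (k : ℝ) ≤ 2 ^ k := by exact_mod_cast (Nat.lt_two_pow_self (n := k)).le
  rw [_root_.eulerCoeff, abs_mul, Nat.abs_cast, mul_pow]
  calc (k : ℝ) * |b k| * r ^ k = |b k| * (k * r ^ k) := by ring
    _ ≤ _ := by gcongr

theorem IsEntire.summable {b : ℕ → ℝ} (hb : IsEntire b) (z : ℝ) :
    Summable fun k => b k * z ^ k := by
  refine Summable.of_norm ?_
  simpa [abs_mul, abs_pow] using hb |z| (abs_nonneg z)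

theorem IsEntire.hasSum {b : ℕ → ℝ} (hb : IsEntire b) (z : ℝ) :
    HasSum (fun k => b k * z ^ k) (seriesSum b z) := (hb.summable z).hasSum

theorem seriesSum_zero (b : ℕ → ℝ) : seriesSum b 0 = b 0 := by
  rw [seriesSum, tsum_eq_single 0 (fun k hk => by simp [hk])]
  simp

theorem IsEntire.hasDerivAt {b : ℕ → ℝ} (hb : IsEntire b) (z : ℝ) :
    HasDerivAt (seriesSum b) (seriesSum (_root_.derivCoeff b) z) z := by
  set r := |z| + 1 with hr
  have hr1 : 1 ≤ r := by have := abs_nonneg z; linarith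
  have hz : z ∈ Metric.ball (0 : ℝ) r := by simp [hr]
  have key := hasDerivAt_tsum_of_isPreconnected (u := fun k => |_root_.eulerCoeff b k| * r ^ k)
    (g := fun k z => b k * z ^ k) (g' := fun k z => b k * (k * z ^ (k - 1)))
    (t := Metric.ball 0 r) (y₀ := z) (y := z) (hb.eulerCoeff r (by linarith)) Metric.isOpen_ball
    (convex_ball (0 : ℝ) r).isPreconnected (fun n y _ => (hasDerivAt_pow n y).const_mul (b n))
    (fun n y hy => ?_) hz (hb.summable z) hz
  · refine HasDerivAt.congr_deriv (f := seriesSum b) key ?_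
    have hs : Summable fun k : ℕ => b k * (k * z ^ (k - 1)) := by
      rw [← summable_nat_add_iff 1]
      refine (hb.derivCoeff.summable z).congr fun k => ?_
      simp only [_root_.derivCoeff, Nat.add_sub_cancel]
      push_cast
      ring
    rw [hs.tsum_eq_zero_add, seriesSum]
    simp only [_root_.derivCoeff, Nat.add_sub_cancel, Nat.cast_zero, zero_mul, mul_zero, zero_add]
    refine tsum_congr fun k => ?_
    push_cast
    ring
  · have hy' : |y| ≤ r := by simpa using (Metric.mem_ball.1 hy).le
    rw [_root_.eulerCoeff, Real.norm_eq_abs, abs_mul, abs_mul, abs_mul, Nat.abs_cast, abs_pow]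
    have : |y| ^ (n - 1) ≤ r ^ n :=
      (pow_le_pow_left₀ (abs_nonneg y) hy' _).trans (pow_le_pow_right₀ hr1 (Nat.sub_le n 1))
    calc |b n| * (n * |y| ^ (n - 1)) = n * |b n| * |y| ^ (n - 1) := by ring
      _ ≤ _ := by gcongr

theorem IsEntire.mul_seriesSum_derivCoeff {b : ℕ → ℝ} (hb : IsEntire b) (z : ℝ) :
    z * seriesSum (_root_.derivCoeff b) z = seriesSum (_root_.eulerCoeff b) z := by
  rw [seriesSum, seriesSum, (hb.eulerCoeff.summable z).tsum_eq_zero_add, ← tsum_mul_left]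
  simp only [_root_.eulerCoeff, _root_.derivCoeff, Nat.cast_zero, zero_mul, zero_add]
  refine tsum_congr fun k => ?_
  push_cast
  ring

/-! ### The function `X₀`: differential equation, first integral and signs. -/

/-- The coefficients of `X₀` as a power series in `x ^ 2`. -/
def x0Coeff : ℕ → ℝ
  | 0 => 5 / 2
  | (k + 1) => hypCoeff (k + 1)

/-- The constant term 5/2 is exactly the value that extends the recurrence to `k = 0`, so the
differential equation is homogeneous. -/
theorem x0Coeff_rec (k : ℕ) :
    2 * ((k : ℝ) + 1) * (4 * (k : ℝ) ^ 2 + 5 / 4) * x0Coeff (k + 1)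
      + (2 * (k : ℝ) - 1) * x0Coeff k = 0 := by
  cases k with
  | zero => norm_num [x0Coeff, hypCoeff]
  | succ k =>
    simp only [x0Coeff, hypCoeff]
    have : (4 * ((k : ℝ) + 1) ^ 2 + 5 / 4) ≠ 0 := by positivity
    push_cast
    field_simp
    ring

theorem abs_hypCoeff_le (k : ℕ) : |hypCoeff (k + 1)| ≤ 1 / k.factorial := by
  induction k with
  | zero => simp [hypCoeff]
  | succ k ih =>
    have hk : (0 : ℝ) ≤ k := Nat.cast_nonneg k
    have hd : (0 : ℝ) < 2 * (((k : ℝ) + 1) + 1) * (4 * ((k : ℝ) + 1) ^ 2 + 5 / 4) := by positivity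
    rw [hypCoeff, abs_div, abs_neg, abs_mul, abs_of_pos hd,
      abs_of_pos (by linarith : (0 : ℝ) < 2 * ((k : ℝ) + 1) - 1), Nat.factorial_succ]
    have h1 : (2 * ((k : ℝ) + 1) - 1) / (2 * (((k : ℝ) + 1) + 1) * (4 * ((k : ℝ) + 1) ^ 2 + 5 / 4))
        ≤ 1 / (k + 1) := by
      rw [div_le_div_iff₀ hd (by positivity)]
      nlinarith [mul_nonneg hk hk, mul_nonneg hk (mul_nonneg hk hk)]
    calc _ = (2 * ((k : ℝ) + 1) - 1) /
          (2 * (((k : ℝ) + 1) + 1) * (4 * ((k : ℝ) + 1) ^ 2 + 5 / 4)) * |hypCoeff (k + 1)| := by ring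
      _ ≤ 1 / (k + 1) * (1 / k.factorial) := by gcongr
      _ = _ := by push_cast; field_simp

theorem isEntire_x0Coeff : IsEntire x0Coeff := by
  intro r hr
  rw [← summable_nat_add_iff 1]
  refine Summable.of_nonneg_of_le (fun k => by positivity) (fun k => ?_)
    ((Real.summable_pow_div_factorial r).mul_left r)
  calc |x0Coeff (k + 1)| * r ^ (k + 1) ≤ 1 / k.factorial * r ^ (k + 1) := by
        gcongr; exact abs_hypCoeff_le k
    _ = _ := by ring

/-- `X₀(x) = x0Series (x ^ 2)`. -/
def x0Series : ℝ → ℝ := seriesSum x0Coeff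

/-- The derivative of `x0Series`. -/
def x0Series' : ℝ → ℝ := seriesSum (derivCoeff x0Coeff)

theorem hasDerivAt_x0Series (z : ℝ) : HasDerivAt x0Series (x0Series' z) z :=
  isEntire_x0Coeff.hasDerivAt z

theorem hasDerivAt_x0Series' (z : ℝ) :
    HasDerivAt x0Series' (seriesSum (derivCoeff (derivCoeff x0Coeff)) z) z :=
  isEntire_x0Coeff.derivCoeff.hasDerivAt z

theorem X0_eq (x : ℝ) : X0 x = x0Series (x ^ 2) := by
  rw [x0Series, seriesSum, (isEntire_x0Coeff.summable _).tsum_eq_zero_add, X0]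
  simp only [x0Coeff, pow_mul, pow_zero, mul_one]

theorem hasDerivAt_X0 (x : ℝ) : HasDerivAt X0 (2 * x * x0Series' (x ^ 2)) x := by
  have h := (hasDerivAt_x0Series (x ^ 2)).comp x (hasDerivAt_pow 2 x)
  have e : X0 = x0Series ∘ fun x => x ^ 2 := funext X0_eq
  rw [e]
  refine h.congr_deriv ?_
  norm_num
  ring

theorem deriv_X0 (x : ℝ) : deriv X0 x = 2 * x * x0Series' (x ^ 2) := (hasDerivAt_X0 x).deriv

theorem differentiableAt_x0Series'_sq (x : ℝ) :
    DifferentiableAt ℝ (fun x => x0Series' (x ^ 2)) x :=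
  ((hasDerivAt_x0Series' (x ^ 2)).comp x (hasDerivAt_pow 2 x)).differentiableAt

/-- The differential equation of `X₀`, in the variable `z = x ^ 2`. -/
theorem x0Series_ode (z : ℝ) :
    8 * seriesSum (eulerCoeff (eulerCoeff (derivCoeff x0Coeff))) z + 5 / 2 * x0Series' z
      + 2 * (z * x0Series' z) - x0Series z = 0 := by
  have hb := isEntire_x0Coeff
  have h1 := (hb.derivCoeff.eulerCoeff.eulerCoeff.hasSum z).mul_left 8
  have h2 := (hb.derivCoeff.hasSum z).mul_left (5 / 2)
  have h3 := (hb.eulerCoeff.hasSum z).mul_left 2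
  have h := ((h1.add h2).add h3).sub (hb.hasSum z)
  rw [x0Series', hb.mul_seriesSum_derivCoeff, x0Series]
  refine h.unique ?_
  refine hasSum_zero.congr_fun fun k => ?_
  simp only [eulerCoeff, derivCoeff]
  linear_combination z ^ k * x0Coeff_rec k

/-- A quadratic first integral of the differential equation. -/
theorem x0Series_first_integral (z : ℝ) :
    4 * (x0Series z - z * x0Series' z) * x0Series' z =
      16 * seriesSum (eulerCoeff (derivCoeff x0Coeff)) z ^ 2 + 5 * x0Series' z ^ 2 + 5 := by
  have hb := isEntire_x0Coeff.derivCoeff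
  have hd : ∀ z, HasDerivAt (fun z => 16 * seriesSum (eulerCoeff (derivCoeff x0Coeff)) z ^ 2
      + 5 * x0Series' z ^ 2 + 5 - 4 * (x0Series z - z * x0Series' z) * x0Series' z) 0 z := by
    intro z
    have h1 := hb.eulerCoeff.hasDerivAt z
    have h2 := hasDerivAt_x0Series' z
    have h3 := hasDerivAt_x0Series z
    have h := ((((h1.pow 2).const_mul 16).add ((h2.pow 2).const_mul 5)).add_const 5).sub
      (((h3.sub ((hasDerivAt_id z).mul h2)).const_mul 4).mul h2)
    refine h.congr_deriv ?_
    have e1 := hb.mul_seriesSum_derivCoeff z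
    have e2 := hb.eulerCoeff.mul_seriesSum_derivCoeff z
    have e3 := x0Series_ode z
    simp only [id, Pi.sub_apply, Pi.mul_apply, Nat.cast_ofNat]
    rw [← e2] at e3
    rw [← e1]
    -- The derivative is `4 X''` times the left side of the differential equation.
    linear_combination 4 * seriesSum (derivCoeff (derivCoeff x0Coeff)) z * e3
  have hc := is_const_of_deriv_eq_zero (fun z => (hd z).differentiableAt)
    (fun z => (hd z).deriv) z 0
  simp only [x0Series', x0Series, seriesSum_zero] at hc ⊢
  -- The constant is fixed at `z = 0`, where `X = 5/2`, `X' = 1` and `z X'' = 0`: both sides equal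
  -- 10.
  norm_num [eulerCoeff, derivCoeff, x0Coeff, hypCoeff] at hc
  linarith

/-- A zero of `X'` would make the left side of the first integral 0 and the right side at least 5;
continuity and `X'(0) = 1` then fix the sign. -/
theorem x0Series'_pos (z : ℝ) : 0 < x0Series' z := by
  have hne : ∀ z, x0Series' z ≠ 0 := fun z h => by
    have := x0Series_first_integral z
    rw [h] at this
    nlinarith [sq_nonneg (seriesSum (eulerCoeff (derivCoeff x0Coeff)) z)]
  have h0 : x0Series' 0 = 1 := by
    norm_num [x0Series', seriesSum_zero, derivCoeff, x0Coeff, hypCoeff]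
  have hc : Continuous x0Series' :=
    continuous_iff_continuousAt.2 fun z => (hasDerivAt_x0Series' z).continuousAt
  by_contra! hz
  obtain ⟨w, hw⟩ := mem_range_of_exists_le_of_exists_ge hc ⟨z, hz⟩ ⟨0, by rw [h0]; norm_num⟩
  exact hne w hw

/-- The right side of the first integral is positive, and so is the factor `X'` on the left. -/
theorem x0Series_sub_pos (z : ℝ) : 0 < x0Series z - z * x0Series' z := by
  have h := x0Series_first_integral z
  have h' := x0Series'_pos z
  by_contra! hz
  nlinarith [sq_nonneg (seriesSum (eulerCoeff (derivCoeff x0Coeff)) z), sq_nonneg (x0Series' z),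
    mul_nonneg (sub_nonneg.2 hz) h'.le]

theorem hFun_eq {x : ℝ} (hx : 0 < x) (y : ℝ) :
    hFun x y = 2 * (x0Series (x ^ 2) - x ^ 2 * x0Series' (x ^ 2))
      + y ^ 2 * (2 * x0Series' (x ^ 2)) + √5 := by
  rw [hFun, deriv_X0, X0_eq]
  field_simp

theorem hFun_pos {x : ℝ} (hx : 0 < x) (y : ℝ) : 0 < hFun x y := by
  rw [hFun_eq hx]
  have h1 := x0Series_sub_pos (x ^ 2)
  have h2 := x0Series'_pos (x ^ 2)
  positivity

theorem differentiableAt_hFun {x : ℝ} (hx : 0 < x) (y : ℝ) :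
    DifferentiableAt ℝ (fun s => hFun s y) x := by
  have h1 := differentiableAt_x0Series'_sq x
  have h2 : DifferentiableAt ℝ (fun x => x0Series (x ^ 2)) x :=
    ((hasDerivAt_x0Series (x ^ 2)).comp x (hasDerivAt_pow 2 x)).differentiableAt
  have : DifferentiableAt ℝ (fun x => 2 * (x0Series (x ^ 2) - x ^ 2 * x0Series' (x ^ 2))
      + y ^ 2 * (2 * x0Series' (x ^ 2)) + √5) x := by fun_prop
  refine this.congr_of_eventuallyEq ?_
  filter_upwards [lt_mem_nhds hx] with s hs using hFun_eq hs y

/-! ### The criterion for a (2,3,4) cusp. -/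

theorem lowestDerivOrder_add_two {w l g : ℝ → ℝ} {t : ℝ} {n : ℕ} (hw : w t = 0)
    (hl : ContDiffAt ℝ ∞ l t) (hg : ContDiffAt ℝ ∞ g t)
    (hd : ∀ᶠ s in 𝓝 t, HasDerivAt w (l s * g s) s) (hl0 : l t = 0) (hl1 : deriv l t ≠ 0)
    (h : LowestDerivOrder g t n) : LowestDerivOrder w t (n + 2) := by
  have key : ∀ k, iteratedDeriv (k + 1) w t = ∑ i ∈ Finset.range (k + 1),
      (k.choose i : ℝ) * iteratedDeriv i l t * iteratedDeriv (k - i) g t := by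
    intro k
    have e : deriv w =ᶠ[𝓝 t] l * g := hd.mono fun s hs => hs.deriv
    rw [iteratedDeriv_succ', e.iteratedDeriv_eq k]
    exact iteratedDeriv_mul (hl.of_le (by exact_mod_cast le_top))
      (hg.of_le (by exact_mod_cast le_top))
  refine ⟨fun k hk => ?_, ?_⟩
  · cases k with
    | zero => simpa using hw
    | succ k =>
      rw [key]
      refine Finset.sum_eq_zero fun i hi => ?_
      rw [Finset.mem_range] at hi
      cases i with
      | zero => simp [hl0]
      | succ i => rw [h.1 (k - (i + 1)) (by omega), mul_zero]
  -- In the Leibniz sum for `(l g)⁽ⁿ⁺¹⁾` the term `i = 0` dies with `l t` and the terms `i ≥ 2` with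
  -- the low derivatives of `g`; what remains is `(n + 1) l' g⁽ⁿ⁾`.
  · rw [key, Finset.sum_eq_single 1]
    · have : n + 1 - 1 = n := by omega
      rw [this, iteratedDeriv_one]
      refine mul_ne_zero (mul_ne_zero ?_ hl1) h.2
      simp; positivity
    · intro i hi h1
      rw [Finset.mem_range] at hi
      cases i with
      | zero => simp [hl0]
      | succ i => rw [h.1 (n + 1 - (i + 1)) (by omega), mul_zero]
    · intro h1
      simp at h1

/-- A curve whose tangent `T` belongs to an adapted orthonormal frame `T, U, V, W` with constant
`W` has a `(2,3,4)` cusp where its signed speed `l` has a simple zero, provided that the curvatures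
`k` and `r k` in the directions `U` and `V` satisfy `k ≠ 0` and `r' ≠ 0`. -/
theorem hasCusp234_of_frame {γ T U V W : ℝ → E4} {l k r : ℝ → ℝ} {t l' r' : ℝ}
    (hγ : ContDiffAt ℝ ∞ γ t) (hTs : ContDiffAt ℝ ∞ T t)
    (ho : ∀ᶠ s in 𝓝 t, Orthonormal ℝ ![T s, U s, V s, W s])
    (hd : ∀ᶠ s in 𝓝 t, HasDerivAt γ (l s • T s) s)
    (hT : ∀ᶠ s in 𝓝 t, HasDerivAt T (k s • (U s + r s • V s)) s)
    (hU : HasDerivAt U (-k t • T t) t) (hV : HasDerivAt V (-(r t * k t) • T t) t)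
    (hW : ∀ᶠ s in 𝓝 t, HasDerivAt W 0 s)
    (hl0 : l t = 0) (hl : HasDerivAt l l' t) (hl' : l' ≠ 0)
    (hk : DifferentiableAt ℝ k t) (hk0 : k t ≠ 0) (hr : HasDerivAt r r' t) (hr' : r' ≠ 0) :
    HasCusp234 γ t := by
  have inn : ∀ s, Orthonormal ℝ ![T s, U s, V s, W s] →
      ((inner ℝ (T s) (T s) = 1 ∧ inner ℝ (U s) (U s) = 1 ∧ inner ℝ (V s) (V s) = 1 ∧
        inner ℝ (W s) (W s) = 1) ∧ inner ℝ (T s) (U s) = 0 ∧ inner ℝ (T s) (V s) = 0 ∧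
        inner ℝ (T s) (W s) = 0 ∧ inner ℝ (U s) (V s) = 0 ∧ inner ℝ (U s) (W s) = 0 ∧
        inner ℝ (V s) (W s) = 0) := by
    intro s hs
    have h := orthonormal_iff_ite.1 hs
    refine ⟨⟨?_, ?_, ?_, ?_⟩, ?_, ?_, ?_, ?_, ?_, ?_⟩
    · simpa using h 0 0
    · simpa using h 1 1
    · simpa using h 2 2
    · simpa using h 3 3
    · simpa using h 0 1
    · simpa using h 0 2
    · simpa using h 0 3
    · simpa using h 1 2
    · simpa using h 1 3
    · simpa using h 2 3
  obtain ⟨⟨iTT, iUU, iVV, iWW⟩, iTU, iTV, iTW, iUV, iUW, iVW⟩ := inn t ho.self_of_nhds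
  have iUT : inner ℝ (U t) (T t) = 0 := by rw [real_inner_comm]; exact iTU
  have iVT : inner ℝ (V t) (T t) = 0 := by rw [real_inner_comm]; exact iTV
  have iVU : inner ℝ (V t) (U t) = 0 := by rw [real_inner_comm]; exact iUV
  -- the signed speed is smooth
  have hls : ContDiffAt ℝ ∞ l t := by
    have h1 : ContDiffAt ℝ ∞ (fun s => inner ℝ (deriv γ s) (T s)) t := by
      refine ContDiffAt.inner ℝ ?_ hTs
      have h2 := (hγ.fderiv_right (m := ∞) (by simp)).clm_apply (contDiffAt_const (c := (1 : ℝ)))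
      simpa using h2
    refine h1.congr_of_eventuallyEq ?_
    filter_upwards [ho, hd] with s h2 h3
    rw [h3.deriv, real_inner_smul_left, (inn s h2).1.1, mul_one]
  -- the coordinates of the curve
  have main : ∀ (v : E4) (n : ℕ), LowestDerivOrder (fun s => inner ℝ (T s) v) t n →
      LowestDerivOrder (fun s => inner ℝ (γ s - γ t) v) t (n + 2) := by
    intro v n hv
    refine lowestDerivOrder_add_two (by simp) hls (hTs.inner ℝ contDiffAt_const) ?_ hl0
      (by rwa [hl.deriv]) hv
    filter_upwards [hd] with s hs
    have := (hs.sub_const (γ t)).inner ℝ (hasDerivAt_const s v)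
    simpa [real_inner_smul_left] using this
  have gd : ∀ v : E4, ∀ᶠ s in 𝓝 t, HasDerivAt (fun s => inner ℝ (T s) v)
      (k s * (inner ℝ (U s) v + r s * inner ℝ (V s) v)) s := by
    intro v
    filter_upwards [hT] with s hs
    have := hs.inner ℝ (hasDerivAt_const s v)
    simpa [real_inner_smul_left, inner_add_left, mul_add] using this
  set N := √(1 + r t ^ 2) with hN
  have hNpos : 0 < N := by positivity
  have hN2 : N ^ 2 = 1 + r t ^ 2 := Real.sq_sqrt (by positivity)
  -- The second vector is the direction of `T'` at `t`; the third completes it in the plane of `U`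
  -- and `V`.
  refine ⟨hγ, ![T t, N⁻¹ • (U t + r t • V t), N⁻¹ • (V t - r t • U t), W t], ?_, ?_, ?_, ?_, ?_⟩
  · rw [orthonormal_iff_ite]
    have e : N⁻¹ * (N⁻¹ * (1 + r t * r t)) = 1 := by
      rw [← sq, ← hN2]; field_simp
    intro i j
    have iWT : inner ℝ (W t) (T t) = 0 := by rw [real_inner_comm]; exact iTW
    have iWU : inner ℝ (W t) (U t) = 0 := by rw [real_inner_comm]; exact iUW
    have iWV : inner ℝ (W t) (V t) = 0 := by rw [real_inner_comm]; exact iVW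
    fin_cases i <;> fin_cases j <;>
      simp only [Fin.zero_eta, Fin.mk_one, Fin.reduceFinMk, Matrix.cons_val, real_inner_smul_left,
        real_inner_smul_right, inner_add_left, inner_add_right, inner_sub_left, inner_sub_right,
        iTT, iUU, iVV, iWW, iTU, iTV, iTW, iUV, iUW, iVW, iUT, iVT, iVU, iWT, iWU, iWV,
        Fin.isValue, Fin.reduceEq, if_true, if_false] <;>
      first | ring1 | linear_combination e
  · obtain ⟨ε, hε, hb⟩ := Metric.eventually_nhds_iff_ball.1 (ho.and (hd.and hW))
    have hWc : ∀ s ∈ Metric.ball t ε, W s = W t := fun s hs =>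
      (convex_ball t ε).is_const_of_fderivWithin_eq_zero (𝕜 := ℝ)
        (fun x hx => (hb x hx).2.2.differentiableAt.differentiableWithinAt)
        (fun x hx => by
          rw [((hb x hx).2.2.hasFDerivAt.hasFDerivWithinAt).fderivWithin
            (Metric.isOpen_ball.uniqueDiffWithinAt hx)]
          ext; simp) hs (Metric.mem_ball_self hε)
    have hd0 : ∀ s ∈ Metric.ball t ε,
        HasDerivAt (fun s => inner ℝ (γ s - γ t) (W t)) (0 : ℝ) s := by
      intro s hs
      have := ((hb s hs).2.1.sub_const (γ t)).inner ℝ (hasDerivAt_const s (W t))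
      refine this.congr_deriv ?_
      rw [← hWc s hs, real_inner_smul_left, (inn s (hb s hs).1).2.2.2.1]
      simp
    filter_upwards [Metric.ball_mem_nhds t hε] with s hs
    have := (convex_ball t ε).is_const_of_fderivWithin_eq_zero (𝕜 := ℝ)
        (fun x hx => (hd0 x hx).differentiableAt.differentiableWithinAt)
        (fun x hx => by
          rw [((hd0 x hx).hasFDerivAt.hasFDerivWithinAt).fderivWithin
            (Metric.isOpen_ball.uniqueDiffWithinAt hx)]
          ext; simp) hs (Metric.mem_ball_self hε)
    simpa using this
  · refine main _ 0 ⟨fun j hj => absurd hj (Nat.not_lt_zero j), ?_⟩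
    have : inner ℝ (T t) (T t) ≠ 0 := by rw [iTT]; exact one_ne_zero
    simpa using this
  · refine main _ 1 ⟨fun j hj => ?_, ?_⟩
    · obtain rfl : j = 0 := by omega
      simp [real_inner_smul_right, inner_add_right, iTU, iTV]
    · rw [iteratedDeriv_one, (gd _).self_of_nhds.deriv]
      simp only [Matrix.cons_val, real_inner_smul_right, inner_add_right, iUU, iUV, iVU, iVV]
      have : k t * (N⁻¹ * (1 + r t * 0) + r t * (N⁻¹ * (0 + r t * 1))) = k t * N := by
        rw [show N⁻¹ * (1 + r t * 0) + r t * (N⁻¹ * (0 + r t * 1)) = N⁻¹ * (1 + r t ^ 2) by ring,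
          ← hN2]
        field_simp
      rw [this]
      positivity
  · set v := N⁻¹ • (V t - r t • U t) with hv
    have vT : inner ℝ (T t) v = 0 := by
      simp [hv, real_inner_smul_right, inner_sub_right, iTU, iTV]
    have vU : inner ℝ (U t) v = -(N⁻¹ * r t) := by
      rw [hv, real_inner_smul_right, inner_sub_right, real_inner_smul_right, iUU, iUV]
      ring
    have vV : inner ℝ (V t) v = N⁻¹ := by
      rw [hv, real_inner_smul_right, inner_sub_right, real_inner_smul_right, iVV, iVU]
      ring
    refine main v 2 ⟨fun j hj => ?_, ?_⟩
    · obtain rfl | rfl : j = 0 ∨ j = 1 := by omega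
      · simpa using vT
      · rw [iteratedDeriv_one, (gd v).self_of_nhds.deriv, vU, vV]
        ring
    · have e : deriv (fun s => inner ℝ (T s) v) =ᶠ[𝓝 t]
          fun s => k s * (inner ℝ (U s) v + r s * inner ℝ (V s) v) :=
        (gd v).mono fun s hs => hs.deriv
      have hU' := hU.inner ℝ (hasDerivAt_const t v)
      have hV' := hV.inner ℝ (hasDerivAt_const t v)
      -- At `t` the factor multiplying `k` vanishes, and `U'`, `V'` are multiples of `T`, orthogonal
      -- to `v`; only `k r' / N` survives.
      have h2 := hk.hasDerivAt.mul (hU'.add (hr.mul hV'))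
      rw [iteratedDeriv_succ', iteratedDeriv_one, e.deriv_eq]
      erw [h2.deriv]
      simp only [real_inner_smul_left, vT, vU, vV, inner_zero_right, Pi.add_apply, Pi.mul_apply]
      have : deriv k t * (-(N⁻¹ * r t) + r t * N⁻¹) + k t * (0 + -k t * 0
          + (r' * N⁻¹ + r t * (0 + -(r t * k t) * 0))) = k t * (r' * N⁻¹) := by ring
      rw [this]
      positivity

/-! ### Moving frames along the coordinate curves. -/

theorem hasDerivAt_mul_of_eq_zero {p g : ℝ → ℝ} {t p' : ℝ} (hp : HasDerivAt p p' t)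
    (hp0 : p t = 0) (hg : DifferentiableAt ℝ g t) :
    HasDerivAt (fun s => p s * g s) (p' * g t) t :=
  (hp.mul hg.hasDerivAt).congr_deriv (by simp [hp0])

theorem orthonormal_rotate {a b c d : E4} {p q : ℝ} (hpq : p ^ 2 + q ^ 2 = 1)
    (h : Orthonormal ℝ ![a, b, c, d]) :
    Orthonormal ℝ ![a, b, p • c + q • d, q • c - p • d] := by
  have hi := orthonormal_iff_ite.1 h
  have i00 := hi 0 0
  have i01 := hi 0 1
  have i02 := hi 0 2
  have i03 := hi 0 3
  have i10 := hi 1 0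
  have i11 := hi 1 1
  have i12 := hi 1 2
  have i13 := hi 1 3
  have i20 := hi 2 0
  have i21 := hi 2 1
  have i22 := hi 2 2
  have i23 := hi 2 3
  have i30 := hi 3 0
  have i31 := hi 3 1
  have i32 := hi 3 2
  have i33 := hi 3 3
  simp only [Matrix.cons_val, Fin.isValue, Fin.reduceEq, if_true, if_false] at *
  rw [orthonormal_iff_ite]
  intro i j
  fin_cases i <;> fin_cases j <;>
    simp only [Fin.zero_eta, Fin.mk_one, Fin.reduceFinMk, Matrix.cons_val, real_inner_smul_left,
      real_inner_smul_right, inner_add_left, inner_add_right, inner_sub_left, inner_sub_right,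
      i00, i01, i02, i03, i10, i11, i12, i13, i20, i21, i22, i23, i30, i31, i32, i33,
      Fin.isValue, Fin.reduceEq, if_true, if_false] <;>
    first | ring1 | linear_combination hpq

namespace IsFrameField

variable {F : Fin 4 → ℝ × ℝ → E4}

theorem orthonormal_comp (hF : IsFrameField F) {x : ℝ} (hx : 0 < x) (y : ℝ) {σ : Fin 4 → Fin 4}
    (hσ : Function.Injective σ) :
    Orthonormal ℝ ![F (σ 0) (x, y), F (σ 1) (x, y), F (σ 2) (x, y), F (σ 3) (x, y)] := by
  have h := (hF.orthonormal (x, y) hx).comp σ hσ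
  convert h using 1
  ext i : 1
  fin_cases i <;> rfl

theorem dx0 (hF : IsFrameField F) {x : ℝ} (hx : 0 < x) (y : ℝ) :
    HasDerivAt (fun s => F 0 (s, y)) (-coeffA1 x y • F 1 (x, y)) x := by
  simpa [Fin.sum_univ_four, omega1] using hF.deriv_x x y hx 0

theorem dx1 (hF : IsFrameField F) {x : ℝ} (hx : 0 < x) (y : ℝ) :
    HasDerivAt (fun s => F 1 (s, y)) (coeffA1 x y • F 0 (x, y) + -coeffC1 x y • F 2 (x, y)
      + -coeffB1 x y • F 3 (x, y)) x := by
  simpa [Fin.sum_univ_four, omega1] using hF.deriv_x x y hx 1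

theorem dx2 (hF : IsFrameField F) {x : ℝ} (hx : 0 < x) (y : ℝ) :
    HasDerivAt (fun s => F 2 (s, y)) (coeffC1 x y • F 1 (x, y)) x := by
  simpa [Fin.sum_univ_four, omega1] using hF.deriv_x x y hx 2

theorem dx3 (hF : IsFrameField F) {x : ℝ} (hx : 0 < x) (y : ℝ) :
    HasDerivAt (fun s => F 3 (s, y)) (coeffB1 x y • F 1 (x, y)) x := by
  simpa [Fin.sum_univ_four, omega1] using hF.deriv_x x y hx 3

theorem dy0 (hF : IsFrameField F) {x : ℝ} (hx : 0 < x) (y : ℝ) :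
    HasDerivAt (fun s => F 0 (x, s)) (-coeffA2 x y • F 2 (x, y)) y := by
  simpa [Fin.sum_univ_four, omega2] using hF.deriv_y x y hx 0

theorem dy1 (hF : IsFrameField F) {x : ℝ} (hx : 0 < x) (y : ℝ) :
    HasDerivAt (fun s => F 1 (x, s)) (coeffC2 x y • F 2 (x, y)) y := by
  simpa [Fin.sum_univ_four, omega2] using hF.deriv_y x y hx 1

theorem dy2 (hF : IsFrameField F) {x : ℝ} (hx : 0 < x) (y : ℝ) :
    HasDerivAt (fun s => F 2 (x, s)) (coeffA2 x y • F 0 (x, y) + -coeffC2 x y • F 1 (x, y)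
      + -coeffB2 x y • F 3 (x, y)) y := by
  simpa [Fin.sum_univ_four, omega2] using hF.deriv_y x y hx 2

theorem dy3 (hF : IsFrameField F) {x : ℝ} (hx : 0 < x) (y : ℝ) :
    HasDerivAt (fun s => F 3 (x, s)) (coeffB2 x y • F 2 (x, y)) y := by
  simpa [Fin.sum_univ_four, omega2] using hF.deriv_y x y hx 3

end IsFrameField

theorem contDiffAt_xCurve {g : ℝ × ℝ → E4} (hg : AnalyticOnNhd ℝ g halfPlane) {x : ℝ} (hx : 0 < x)
    (y : ℝ) : ContDiffAt ℝ ∞ (fun s => g (s, y)) x :=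
  ((hg (x, y) hx).contDiffAt (n := ∞)).comp x (contDiffAt_id.prodMk contDiffAt_const)

theorem contDiffAt_yCurve {g : ℝ × ℝ → E4} (hg : AnalyticOnNhd ℝ g halfPlane) {x : ℝ} (hx : 0 < x)
    (y : ℝ) : ContDiffAt ℝ ∞ (fun s => g (x, s)) y :=
  ((hg (x, y) hx).contDiffAt (n := ∞)).comp y (contDiffAt_const.prodMk contDiffAt_id)

/-- On the diagonal `y = x` the terms in `X₀'` cancel, so this is half of `h(x,x)`. -/
theorem X0_add_pos {x : ℝ} (hx : 0 < x) : 0 < X0 x + √5 / 2 := by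
  have h := hFun_pos hx x
  have e : hFun x x = 2 * (X0 x + √5 / 2) := by
    rw [hFun]; field_simp; ring
  linarith

theorem coeffA1_eq (x y : ℝ) : coeffA1 x y = -y * coeffC1 x y := by
  rw [coeffA1, coeffC1]; ring

/-! ### Cusps of the x-curves and the y-curves. -/

theorem hasCusp234_xCurve {F : Fin 4 → ℝ × ℝ → E4} {f : ℝ × ℝ → E4}
    (hf : IsCurvatureSurfaceOf F f) {y : ℝ} (hy : y ≠ 0) : HasCusp234 (fun x => f (x, y)) |y| := by
  have hF := hf.frame
  have ht : 0 < |y| := abs_pos.2 hy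
  have ev : ∀ᶠ s in 𝓝 |y|, 0 < s := lt_mem_nhds ht
  set t := |y| with htdef
  have hty : t ^ 2 - y ^ 2 = 0 := by rw [htdef, sq_abs, sub_self]
  set n := √(1 + y ^ 2) with hn
  have hn0 : 0 < n := by positivity
  have hn2 : n ^ 2 = 1 + y ^ 2 := Real.sq_sqrt (by positivity)
  have hsq : HasDerivAt (fun s : ℝ => s ^ 2 - y ^ 2) (2 * t) t := by
    simpa using (hasDerivAt_pow 2 t).sub_const (y ^ 2)
  have hXd : DifferentiableAt ℝ X0 t := (hasDerivAt_X0 t).differentiableAt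
  have hhd := differentiableAt_hFun ht y
  have hh0 := (hFun_pos ht y).ne'
  have hS0 := X0_add_pos ht
  -- As `a₁ = -y c₁`, the φ and X_β parts of `∂ₓX_α` combine to `-c₁ (y φ + X_β)`; this gives `U`,
  -- its orthogonal complement is `W`, and `r = b₁ / (n c₁)`.
  refine hasCusp234_of_frame (T := fun s => F 1 (s, y))
    (U := fun s => (y / n) • F 0 (s, y) + (1 / n) • F 2 (s, y)) (V := fun s => F 3 (s, y))
    (W := fun s => (1 / n) • F 0 (s, y) - (y / n) • F 2 (s, y))
    (l := fun s => (s ^ 2 - y ^ 2) * (1 / (s * hFun s y)))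
    (k := fun s => -coeffC1 s y * n)
    (r := fun s => 1 / (2 * n) + (s ^ 2 - y ^ 2) * (√5 / (2 * n * (X0 s + √5 / 2))))
    (l' := 2 * t * (1 / (t * hFun t y))) (r' := 2 * t * (√5 / (2 * n * (X0 t + √5 / 2))))
    (contDiffAt_xCurve hf.analytic ht y) (contDiffAt_xCurve (hF.analytic 1) ht y)
    ?_ ?_ ?_ ?_ ?_ ?_ ?_ ?_ ?_ ?_ ?_ ?_ ?_
  · filter_upwards [ev] with s hs
    have h := orthonormal_rotate (p := y / n) (q := 1 / n)
      (by field_simp; linarith) (hF.orthonormal_comp hs y (σ := ![1, 3, 0, 2]) (by decide))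
    -- The rotation delivers the order T, V, U, W.
    have h' := h.comp ![0, 2, 1, 3] (by decide)
    convert h' using 1
    ext i : 1
    fin_cases i <;> rfl
  · filter_upwards [ev] with s hs
    refine (hf.deriv_x s y hs).congr_deriv ?_
    congr 1
    ring
  · filter_upwards [ev] with s hs
    refine (hF.dx1 hs y).congr_deriv ?_
    have hr : -coeffB1 s y = -coeffC1 s y * n *
        (1 / (2 * n) + (s ^ 2 - y ^ 2) * (√5 / (2 * n * (X0 s + √5 / 2)))) := by
      have h1 := (X0_add_pos hs).ne'
      have h2 := (hFun_pos hs y).ne'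
      rw [coeffB1, coeffC1]
      generalize X0 s + √5 / 2 = S at *
      field_simp
    rw [coeffA1_eq, hr]
    match_scalars <;> field_simp
  · refine (((hF.dx0 ht y).const_smul (y / n)).add
      ((hF.dx2 ht y).const_smul (1 / n))).congr_deriv ?_
    rw [coeffA1_eq]
    match_scalars
    field_simp
    rw [hn2]; ring
  · refine (hF.dx3 ht y).congr_deriv ?_
    have h1 := hS0.ne'
    rw [hty, coeffB1, coeffC1, hty]
    congr 1
    field_simp
    ring
  · filter_upwards [ev] with s hs
    refine (((hF.dx0 hs y).const_smul (1 / n)).sub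
      ((hF.dx2 hs y).const_smul (y / n))).congr_deriv ?_
    rw [coeffA1_eq]
    match_scalars
    ring
  · simp [hty]
  · refine hasDerivAt_mul_of_eq_zero hsq hty ?_
    have : t * hFun t y ≠ 0 := mul_ne_zero ht.ne' hh0
    fun_prop (disch := assumption)
  · have := hFun_pos ht y
    positivity
  · have : t * hFun t y ≠ 0 := mul_ne_zero ht.ne' hh0
    unfold coeffC1
    fun_prop (disch := assumption)
  · rw [coeffC1]
    have := hFun_pos ht y
    refine mul_ne_zero (neg_ne_zero.2 (mul_ne_zero ?_ hS0.ne')) hn0.ne'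
    exact div_ne_zero (by norm_num) (by positivity)
  · refine (hasDerivAt_mul_of_eq_zero hsq hty ?_).const_add _
    have : 2 * n * (X0 t + √5 / 2) ≠ 0 := by positivity
    fun_prop (disch := assumption)
  · positivity

theorem hasCusp234_yCurve {F : Fin 4 → ℝ × ℝ → E4} {f : ℝ × ℝ → E4}
    (hf : IsCurvatureSurfaceOf F f) {x : ℝ} (hx : 0 < x) : HasCusp234 (fun y => f (x, y)) 0 := by
  have hF := hf.frame
  have hh := fun s => (hFun_pos hx s).ne'
  have hhd : DifferentiableAt ℝ (fun s => hFun x s) 0 := by unfold hFun; fun_prop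
  set M : ℝ → ℝ := fun s => 2 * X0 x + √5 - (x ^ 2 + s ^ 2) * (deriv X0 x / x) with hM
  have hMd : Differentiable ℝ M := by fun_prop
  have hM0 : M 0 = hFun x 0 := by
    simp only [hM, hFun]; field_simp; ring
  have hMpos : 0 < M 0 := hM0 ▸ hFun_pos hx 0
  -- `M` is a denominator of `r`; its sign is known only at 0, where it equals `h(x,0)`.
  have hMne : ∀ᶠ s in 𝓝 0, M s ≠ 0 := hMd.continuous.continuousAt.eventually_ne hMpos.ne'
  have ha : ∀ s, coeffA2 x s = -1 / hFun x s * M s := fun s => rfl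
  set B := deriv X0 x / (2 * x) + √5 with hB
  set C := deriv (deriv X0) x - deriv X0 x / x with hC
  -- This makes `n` nonzero whatever the value of `C`.
  have hBpos : 0 < B := by
    have h1 := x0Series'_pos (x ^ 2)
    have : B = x0Series' (x ^ 2) + √5 := by
      rw [hB, deriv_X0]; field_simp
    rw [this]; positivity
  have hb : ∀ s, coeffB2 x s = -2 * s / hFun x s * B := fun s => rfl
  have hc : ∀ s, coeffC2 x s = 2 * s / hFun x s * C := fun s => rfl
  set n := √(B ^ 2 + C ^ 2) with hn
  have hn0 : 0 < n := by positivity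
  have hn2 : n ^ 2 = B ^ 2 + C ^ 2 := Real.sq_sqrt (by positivity)
  -- The ξ and X_α parts of `∂_yX_β` are `(2y/h)(B ξ - C X_α)`, of fixed direction `V`; the factor
  -- `y` gives `r` its simple zero at 0.
  refine hasCusp234_of_frame (T := fun s => F 2 (x, s)) (U := fun s => F 0 (x, s))
    (V := fun s => (B / n) • F 3 (x, s) + (-C / n) • F 1 (x, s))
    (W := fun s => (-C / n) • F 3 (x, s) - (B / n) • F 1 (x, s))
    (l := fun s => s * (2 / hFun x s))
    (k := fun s => coeffA2 x s) (r := fun s => s * (-2 * n / M s))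
    (l' := 1 * (2 / hFun x 0)) (r' := 1 * (-2 * n / M 0))
    (contDiffAt_yCurve hf.analytic hx 0) (contDiffAt_yCurve (hF.analytic 2) hx 0)
    ?_ ?_ ?_ ?_ ?_ ?_ ?_ ?_ ?_ ?_ ?_ ?_ ?_
  · refine Eventually.of_forall fun s => ?_
    exact orthonormal_rotate (p := B / n) (q := -C / n) (by field_simp; linarith)
      (hF.orthonormal_comp hx s (σ := ![2, 0, 3, 1]) (by decide))
  · refine Eventually.of_forall fun s => (hf.deriv_y x s hx).congr_deriv ?_
    congr 1
    ring
  · filter_upwards [hMne] with s hs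
    refine (hF.dy2 hx s).congr_deriv ?_
    rw [ha, hb, hc]
    have := hh s
    match_scalars <;> field_simp
  · exact hF.dy0 hx 0
  · refine (((hF.dy3 hx 0).const_smul (B / n)).add
      ((hF.dy1 hx 0).const_smul (-C / n))).congr_deriv ?_
    rw [hb, hc]
    match_scalars
    ring
  · refine Eventually.of_forall fun s => (((hF.dy3 hx s).const_smul (-C / n)).sub
      ((hF.dy1 hx s).const_smul (B / n))).congr_deriv ?_
    rw [hb, hc]
    match_scalars
    ring
  · simp
  · refine hasDerivAt_mul_of_eq_zero (hasDerivAt_id 0) rfl ?_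
    have := hh 0
    fun_prop (disch := assumption)
  · have := hFun_pos hx 0
    positivity
  · simp only [ha]
    have := hh 0
    fun_prop (disch := assumption)
  · rw [ha]
    exact mul_ne_zero (div_ne_zero (by norm_num) (hh 0)) hMpos.ne'
  · refine hasDerivAt_mul_of_eq_zero (hasDerivAt_id 0) rfl ?_
    have := hMpos.ne'
    have := hMd 0
    fun_prop (disch := assumption)
  · rw [one_mul]
    exact div_ne_zero (mul_ne_zero (by norm_num) hn0.ne') hMpos.ne'

end

theorem mainTheorem5 (F : Fin 4 → ℝ × ℝ → E4) (f : ℝ × ℝ → E4)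
    (hf : IsCurvatureSurfaceOf F f) :
    (∀ y : ℝ, y ≠ 0 → HasCusp234 (fun x => f (x, y)) |y|) ∧
    (∀ x : ℝ, 0 < x → HasCusp234 (fun y => f (x, y)) 0) :=
  ⟨fun _ hy => hasCusp234_xCurve hf hy, fun _ hx => hasCusp234_yCurve hf hx⟩
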